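/- Let $(W,S)$ be a Coxeter system with Coxeter matrix $(m(s,t))_{s,t\in S}$ which is simply laced, i.e. $m(s,t)\le 3$ for all $s,t\in S$, and triangle free, i.e. its Coxeter graph (vertex set $S$, with $s,t$ adjacent if and only if $m(s,t)\ge 3$) contains no three-cycle. For a reduced expression $\alpha$ (a word in $S$), a braid move replaces a factor $sts$ with $m(s,t)=3$ by $tst$; the braid class $[\alpha]$ is the set of all words obtainable from $\alpha$ by finite sequences of braid moves; the braid graph $B(\alpha)$ has vertex set $[\alpha]$, two words being adjacent if and only if they are related by a single braid move. The set $\{i-1,i,i+1\}$ of positions is a braid shadow of $[\alpha]$ if some $\beta\in[\alpha]$ has letters $s,t,s$ with $m(s,t)=3$ in positions $i-1,i,i+1$. A reduced expression $\alpha$ of length $m\ge 1$ is a link if either $m=1$, or $m$ is odd and the set of braid shadows of $[\alpha]$ is exactly $\{\{1,2,3\},\{3,4,5\},\dots,\{m-2,m-1,m\}\}$. If $\alpha$ is a link, then $B(\alpha)$ is a median graph: it is connected, and for all vertices $u,v,w$ there is exactly one vertex $x$ in $I(u,v)\cap I(u,w)\cap I(v,w)$, where $I(u,v)=\{x : d(u,v)=d(u,x)+d(x,v)\}$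 and $d$ is the graph distance. -/

import Mathlib

namespace BraidMedian

variable {B : Type*}

/-! ### Coxeter systems of type Λ

In Mathlib the entry `M s t = 0` of a Coxeter matrix encodes `m(s,t) = ∞`. -/

/-- A Coxeter system is simply laced if `m(s,t) ≤ 3` for all `s, t`; in particular no `m(s,t)` is
infinite. -/
def IsSimplyLaced (M : CoxeterMatrix B) : Prop :=
  ∀ s t : B, M s t ≠ 0 ∧ M s t ≤ 3

/-- The (underlying simple graph of the) Coxeter graph: the vertices are the generators, and `s, t`
are joined if and only if `3 ≤ m(s,t) ≤ ∞`. -/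
def coxeterGraph (M : CoxeterMatrix B) : SimpleGraph B where
  Adj s t := 3 ≤ M s t ∨ M s t = 0
  symm := ⟨fun s t h => by rwa [M.symmetric t s]⟩
  loopless := ⟨fun s h => by simp at h⟩

/-- A Coxeter system is triangle free if its Coxeter graph has no three-cycle. -/
def IsTriangleFree (M : CoxeterMatrix B) : Prop :=
  (coxeterGraph M).CliqueFree 3

/-- Type Λ: simply laced and triangle free. -/
def IsTypeLambda (M : CoxeterMatrix B) : Prop :=
  IsSimplyLaced M ∧ IsTriangleFree M

/-! ### Braid moves, braid classes, braid graphs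

Words in the generators are lists. `CoxeterSystem.braidWord M s t` is the alternating word in
`s, t` of length `m(s,t)` that ends in `t`. -/

/-- `β` is obtained from `α` by a single braid move: a factor which is an alternating word in
`s, t` of length `m(s,t)`, where `3 ≤ m(s,t) < ∞`, is replaced by the other such word. -/
def BraidMove (M : CoxeterMatrix B) (α β : List B) : Prop :=
  ∃ (u v : List B) (s t : B), 3 ≤ M s t ∧
    α = u ++ CoxeterSystem.braidWord M s t ++ v ∧ β = u ++ CoxeterSystem.braidWord M t s ++ v

theorem BraidMove.symm {M : CoxeterMatrix B} {α β : List B} (h : BraidMove M α β) :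
    BraidMove M β α := by
  obtain ⟨u, v, s, t, h3, rfl, rfl⟩ := h
  exact ⟨u, v, t, s, by rwa [M.symmetric t s], rfl, rfl⟩

theorem not_braidMove_self (M : CoxeterMatrix B) (α : List B) : ¬ BraidMove M α α := by
  rintro ⟨u, v, s, t, h3, h1, h2⟩
  have h : CoxeterSystem.braidWord M s t = CoxeterSystem.braidWord M t s :=
    List.append_cancel_left (List.append_cancel_right (h1.symm.trans h2))
  obtain ⟨k, hk⟩ : ∃ k, M s t = k + 1 := ⟨M s t - 1, by omega⟩
  rw [CoxeterSystem.braidWord, CoxeterSystem.braidWord, M.symmetric t s, hk,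
    CoxeterSystem.alternatingWord_succ, CoxeterSystem.alternatingWord_succ] at h
  have hst : t = s := by simpa using congrArg List.getLast? h
  subst hst
  simp at h3

/-- The graph on all words whose edges are the single braid moves. -/
def braidMoveGraph (M : CoxeterMatrix B) : SimpleGraph (List B) where
  Adj := BraidMove M
  symm := ⟨fun _ _ h => h.symm⟩
  loopless := ⟨not_braidMove_self M⟩

/-- The braid class `[α]`: all words reachable from `α` by a finite sequence of braid moves. -/
def braidClass (M : CoxeterMatrix B) (α : List B) : Set (List B) :=
  {β | Relation.ReflTransGen (BraidMove M) α β}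

/-- The braid class of a reduced expression consists of reduced expressions for the same group
element. -/
theorem wordProd_eq_and_isReduced_of_mem_braidClass {M : CoxeterMatrix B} {W : Type*} [Group W]
    (cs : CoxeterSystem M W) {α β : List B} (hα : cs.IsReduced α) (h : β ∈ braidClass M α) :
    cs.wordProd β = cs.wordProd α ∧ cs.IsReduced β := by
  have key : cs.wordProd β = cs.wordProd α ∧ β.length = α.length := by
    induction h with
    | refl => exact ⟨rfl, rfl⟩
    | tail _ hb ih =>
      obtain ⟨u, v, s, t, -, rfl, rfl⟩ := hb
      rw [← ih.1, ← ih.2]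
      simp [CoxeterSystem.wordProd_append, cs.wordProd_braidWord_eq s t, M.symmetric t s]
  refine ⟨key.1, ?_⟩
  rw [CoxeterSystem.IsReduced, key.1, key.2]
  exact hα

/-- The braid graph `B(α)`: its vertex set is the braid class `[α]`, and two vertices are adjacent
if and only if they are related by a single braid move. -/
def braidGraph (M : CoxeterMatrix B) (α : List B) : SimpleGraph (braidClass M α) :=
  (braidMoveGraph M).induce (braidClass M α)

/-! ### Braid shadows and links -/

/-- The set `S(α)` of braid shadows `⟦i-1, i+1⟧` of `α`, each recorded by its center `i`, where
positions in words are counted from `1`: the letters of `α` in the positions `i-1, i, i+1` are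
`s, t, s` with `m(s,t) = 3`. -/
def braidShadows (M : CoxeterMatrix B) (α : List B) : Set ℕ :=
  {i | ∃ (u v : List B) (s t : B), M s t = 3 ∧ α = u ++ [s, t, s] ++ v ∧ i = u.length + 2}

/-- The set `S([α])` of braid shadows of a braid class, each recorded by its center. -/
def classBraidShadows (M : CoxeterMatrix B) (α : List B) : Set ℕ :=
  ⋃ β ∈ braidClass M α, braidShadows M β

/-- A link: a reduced expression `α` of length `m ≥ 1` such that `m = 1`, or `m` is odd and
`S([α]) = {⟦1,3⟧, ⟦3,5⟧, …, ⟦m-2,m⟧}`, that is, the centers are `2, 4, …, m-1`. -/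
def IsLink {M : CoxeterMatrix B} {W : Type*} [Group W] (cs : CoxeterSystem M W) (α : List B) :
    Prop :=
  cs.IsReduced α ∧ (α.length = 1 ∨
    (Odd α.length ∧ classBraidShadows M α = {i | Even i ∧ 2 ≤ i ∧ i + 1 ≤ α.length}))

/-! ### Median graphs -/

/-- The interval `I(u,v)`: the vertices lying on some geodesic between `u` and `v`. -/
def interval {V : Type*} (G : SimpleGraph V) (u v : V) : Set V :=
  {w | G.dist u v = G.dist u w + G.dist w v}

/-- A median graph: a connected graph such that `I(u,v) ∩ I(u,w) ∩ I(v,w)` has exactly one element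
for all vertices `u, v, w`. -/
def IsMedian {V : Type*} (G : SimpleGraph V) : Prop :=
  G.Connected ∧ ∀ u v w : V, ∃! x, x ∈ interval G u v ∩ interval G u w ∩ interval G v w

end BraidMedian

namespace BraidMedian

/-! Number positions from 0 and let the link have length `2 * k + 1`, so that braid moves happen
exactly at the centers `2 * j + 1`, `j < k`. Triangle-freeness forces each center to carry only two
letters `P j`, `Q j` throughout the class (`SlotState.flip`). Recording whether the letter is `P j`
encodes a word as a Boolean vector of length `k`, and a braid move changes one coordinate.

Consecutive pairs share exactly one letter `p j` (`exists_tripleState`), and the only restriction is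
that `p j` never occupies both centers. The braid graph is thus the subgraph of the `k`-cube cut out
by one forbidden pair of values for each two consecutive coordinates. Such a set is closed under
majority and isometric in the cube (`PathConstraint.exists_update`), so majority is the unique
median (`isMedian_of_pathConstraint`, `isMedian_of_flips`). -/

/-! ### Median subgraphs of the hypercube -/

/-- The Boolean vectors in which no two consecutive entries take the excluded values. -/
def PathConstraint {k : ℕ} (e f : ℕ → Bool) (b : Fin k → Bool) : Prop :=
  ∀ (j : ℕ) (h : j + 1 < k), ¬ (b ⟨j, by omega⟩ = e j ∧ b ⟨j + 1, h⟩ = f j)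

/-- This makes graph distance equal Hamming distance. Start at the least coordinate where `b` and
`c` differ. If changing it creates a forbidden pair, the pair lies to the right, and since `c`
avoids it, `b` and `c` also differ at the next coordinate. Move there: the pair on its left is now
harmless, as `b j` is not `e j`. The scan to the right must stop. -/
theorem PathConstraint.exists_update {k : ℕ} {e f : ℕ → Bool} {b c : Fin k → Bool}
    (hb : PathConstraint e f b) (hc : PathConstraint e f c) (hbc : b ≠ c) :
    ∃ j, b j ≠ c j ∧ PathConstraint e f (Function.update b j (c j)) := by
  classical
  have key : ∀ (n j : ℕ) (hj : j < k), k - j = n → b ⟨j, hj⟩ ≠ c ⟨j, hj⟩ →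
      (∀ (i : ℕ) (hi : i + 1 = j), ¬ (b ⟨i, by omega⟩ = e i ∧ c ⟨j, hj⟩ = f i)) →
      ∃ j, b j ≠ c j ∧ PathConstraint e f (Function.update b j (c j)) := by
    intro n
    induction n with
    | zero => intro j hj h; omega
    | succ n ih =>
      intro j hj hn hne hleft
      by_cases hr : ∃ h : j + 1 < k, c ⟨j, hj⟩ = e j ∧ b ⟨j + 1, h⟩ = f j
      · obtain ⟨h, h1, h2⟩ := hr
        have h3 : b ⟨j + 1, h⟩ ≠ c ⟨j + 1, h⟩ := fun h3 => hc j h ⟨h1, h3 ▸ h2⟩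
        refine ih (j + 1) h (by omega) h3 ?_
        rintro i hi ⟨h4, -⟩
        obtain rfl : i = j := by omega
        exact hne (h4.trans h1.symm)
      · refine ⟨⟨j, hj⟩, hne, ?_⟩
        rintro i hi ⟨h1, h2⟩
        by_cases hij : i = j
        · subst hij
          rw [Function.update_self] at h1
          rw [Function.update_of_ne (by simp)] at h2
          exact hr ⟨hi, h1, h2⟩
        · rw [Function.update_of_ne (by simpa using hij)] at h1
          by_cases hij' : i + 1 = j
          · subst hij'
            rw [Function.update_self] at h2
            exact hleft i rfl ⟨h1, h2⟩
          · rw [Function.update_of_ne (by simpa using hij')] at h2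
            exact hb i hi ⟨h1, h2⟩
  have hex : ∃ j : ℕ, ∃ hj : j < k, b ⟨j, hj⟩ ≠ c ⟨j, hj⟩ := by
    obtain ⟨j, hj⟩ := Function.ne_iff.1 hbc
    exact ⟨j, j.2, hj⟩
  obtain ⟨hj, hne⟩ := Nat.find_spec hex
  refine key _ _ hj rfl hne ?_
  rintro i hi ⟨h1, h2⟩
  have h3 : b ⟨i, by omega⟩ = c ⟨i, by omega⟩ := by
    by_contra h3
    exact Nat.find_min hex (m := i) (by omega) ⟨by omega, h3⟩
  have h4 := hc i (by omega)
  simp only [hi] at h4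
  exact h4 ⟨h3 ▸ h1, h2⟩

/-- The coordinatewise majority of three Boolean vectors. -/
def majority {ι : Type*} (a b c : ι → Bool) : ι → Bool :=
  fun i => (a i && b i) || (a i && c i) || (b i && c i)

/-- Each entry of a forbidden pair in the majority would come from two of the three vectors, so one
vector would contain both. -/
theorem PathConstraint.majority {k : ℕ} {e f : ℕ → Bool} {a b c : Fin k → Bool}
    (ha : PathConstraint e f a) (hb : PathConstraint e f b) (hc : PathConstraint e f c) :
    PathConstraint e f (majority a b c) := by
  intro j h
  have h1 := ha j h
  have h2 := hb j h
  have h3 := hc j h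
  simp only [BraidMedian.majority]
  revert h1 h2 h3
  generalize a ⟨j, _⟩ = a1
  generalize a ⟨j + 1, _⟩ = a2
  generalize b ⟨j, _⟩ = b1
  generalize b ⟨j + 1, _⟩ = b2
  generalize c ⟨j, _⟩ = c1
  generalize c ⟨j + 1, _⟩ = c2
  generalize e j = e1
  generalize f j = f1
  revert a1 a2 b1 b2 c1 c2 e1 f1
  decide

/-- The triangle inequality holds coordinate by coordinate, so equality of the sums forces equality
in each term. -/
theorem hammingDist_eq_add_iff {ι : Type*} [Fintype ι] (a b x : ι → Bool) :
    hammingDist a b = hammingDist a x + hammingDist x b ↔ ∀ i, a i = b i → x i = a i := by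
  simp only [hammingDist, Finset.card_filter, ← Finset.sum_add_distrib]
  rw [Finset.sum_eq_sum_iff_of_le]
  · simp only [Finset.mem_univ, forall_const]
    refine forall_congr' fun i => ?_
    cases a i <;> cases b i <;> cases x i <;> simp
  · intro i _
    cases a i <;> cases b i <;> cases x i <;> simp

theorem hammingDist_update_self {ι : Type*} [Fintype ι] [DecidableEq ι] (a : ι → Bool) (j : ι)
    (y : Bool) (h : a j ≠ y) : hammingDist a (Function.update a j y) = 1 := by
  rw [hammingDist, Finset.card_eq_one]
  refine ⟨j, ?_⟩
  ext i
  by_cases hij : i = j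
  · subst hij; simpa using h
  · simp [hij]

theorem hammingDist_update_add_one {ι : Type*} [Fintype ι] [DecidableEq ι] (a b : ι → Bool)
    (j : ι) (h : a j ≠ b j) :
    hammingDist (Function.update a j (b j)) b + 1 = hammingDist a b := by
  have := (hammingDist_eq_add_iff a b (Function.update a j (b j))).2 ?_
  · rw [hammingDist_update_self a j (b j) h] at this
    omega
  · intro i hi
    by_cases hij : i = j
    · subst hij; exact absurd hi h
    · simp [hij]

/-- A graph that embeds in a hypercube as the solution set of path constraints is median. -/
theorem isMedian_of_pathConstraint {V : Type*} [Nonempty V] (G : SimpleGraph V) {k : ℕ}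
    {e f : ℕ → Bool} (φ : V → Fin k → Bool) (hinj : Function.Injective φ)
    (hφ : ∀ v, PathConstraint e f (φ v))
    (hadj : ∀ u v, G.Adj u v → hammingDist (φ u) (φ v) = 1)
    (hflip : ∀ u j, PathConstraint e f (Function.update (φ u) j (!(φ u j))) →
      ∃ v, G.Adj u v ∧ φ v = Function.update (φ u) j (!(φ u j))) :
    IsMedian G := by
  -- Following `exists_update` realizes every solution of the constraints as a vertex, by a walk
  -- whose length is the Hamming distance.
  have hreach : ∀ (n : ℕ) (u : V) (b : Fin k → Bool), PathConstraint e f b →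
      hammingDist (φ u) b = n → ∃ v, φ v = b ∧ ∃ p : G.Walk u v, p.length = n := by
    intro n
    induction n with
    | zero =>
      intro u b _ h
      exact ⟨u, hammingDist_eq_zero.1 h, .nil, rfl⟩
    | succ n ih =>
      intro u b hb h
      obtain ⟨j, hj, hC⟩ := (hφ u).exists_update hb (hammingDist_ne_zero.1 (by omega))
      have hbj : b j = !(φ u j) := by
        revert hj; cases φ u j <;> cases b j <;> simp
      have hd := hammingDist_update_add_one _ _ j hj
      rw [hbj] at hC hd
      obtain ⟨u', hu', hφu'⟩ := hflip u j hC
      obtain ⟨v, hv, p, hp⟩ := ih u' b hb (by rw [hφu']; omega)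
      exact ⟨v, hv, .cons hu' p, by simp [hp]⟩
  have hwalk : ∀ u v, ∃ p : G.Walk u v, p.length = hammingDist (φ u) (φ v) := by
    intro u v
    obtain ⟨v', hv', p, hp⟩ := hreach _ u (φ v) (hφ v) rfl
    obtain rfl := hinj hv'
    exact ⟨p, hp⟩
  have hle : ∀ u v (p : G.Walk u v), hammingDist (φ u) (φ v) ≤ p.length := by
    intro u v p
    induction p with
    | nil => simp
    | @cons u x v h p ih =>
      have := hammingDist_triangle (φ u) (φ x) (φ v)
      rw [hadj _ _ h] at this
      simp only [SimpleGraph.Walk.length_cons]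
      omega
  have hconn : G.Connected := ⟨fun u v => (hwalk u v).elim fun p _ => ⟨p⟩⟩
  have hdist : ∀ u v, G.dist u v = hammingDist (φ u) (φ v) := by
    intro u v
    obtain ⟨p, hp⟩ := hwalk u v
    obtain ⟨q, hq⟩ := hconn.exists_walk_length_eq_dist u v
    exact le_antisymm (hp ▸ SimpleGraph.dist_le p) (hq ▸ hle u v q)
  have hint : ∀ u v x, x ∈ interval G u v ↔ ∀ i, φ u i = φ v i → φ x i = φ u i := by
    intro u v x
    rw [← hammingDist_eq_add_iff, interval, Set.mem_ofPred_eq, hdist, hdist, hdist]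
  refine ⟨hconn, fun u v w => ?_⟩
  obtain ⟨x, hx, -⟩ := hreach _ u _ ((hφ u).majority (hφ v) (hφ w)) rfl
  refine ⟨x, ⟨⟨?_, ?_⟩, ?_⟩, ?_⟩
  · rw [hint, hx]
    intro i
    simp only [majority]
    cases φ u i <;> cases φ v i <;> cases φ w i <;> simp
  · rw [hint, hx]
    intro i
    simp only [majority]
    cases φ u i <;> cases φ v i <;> cases φ w i <;> simp
  · rw [hint, hx]
    intro i
    simp only [majority]
    cases φ u i <;> cases φ v i <;> cases φ w i <;> simp
  · rintro y ⟨⟨h1, h2⟩, h3⟩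
    rw [hint] at h1 h2 h3
    apply hinj
    rw [hx]
    ext1 i
    have h1 := h1 i
    have h2 := h2 i
    have h3 := h3 i
    simp only [majority]
    revert h1 h2 h3
    cases φ u i <;> cases φ v i <;> cases φ w i <;> cases φ y i <;> simp


/-! ### Letters at the centers under flips -/

section Slots

variable {A V : Type*}

/-- The letters of `x` in the positions `i, i + 1, i + 2` are `s, t, s` with `adj s t`. -/
def HasShadow (adj : A → A → Prop) (x : ℕ → A) (i : ℕ) : Prop :=
  adj (x i) (x (i + 1)) ∧ x (i + 2) = x i

/-- `y` is obtained from `x` by replacing `s, t, s` in the positions `i, i + 1, i + 2` by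
`t, s, t`. -/
def Flip (adj : A → A → Prop) (x y : ℕ → A) (i : ℕ) : Prop :=
  HasShadow adj x i ∧ y i = x (i + 1) ∧ y (i + 1) = x i ∧ y (i + 2) = x (i + 1) ∧
    ∀ n, n ≠ i → n ≠ i + 1 → n ≠ i + 2 → y n = x n

/-- The letter of `x` at the center `2 * j + 1` is `b`, and each of the neighbouring letters either
is `a` or has been exchanged for `a` by a flip at the adjacent center. -/
def SlotState (adj : A → A → Prop) (k : ℕ) (x : ℕ → A) (j : ℕ) (a b : A) : Prop :=
  adj a b ∧ x (2 * j + 1) = b ∧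
    (x (2 * j) = a ∨ ∃ i, i + 1 = j ∧ adj a (x (2 * j)) ∧ x (2 * i + 1) = a) ∧
    (x (2 * j + 2) = a ∨ j + 1 < k ∧ adj a (x (2 * j + 2)) ∧ x (2 * j + 3) = a)

theorem HasShadow.slotState {adj : A → A → Prop} {k : ℕ} {x : ℕ → A} {j : ℕ}
    (h : HasShadow adj x (2 * j)) : SlotState adj k x j (x (2 * j)) (x (2 * j + 1)) :=
  ⟨h.1, rfl, .inl rfl, .inl h.2⟩

variable {adj : A → A → Prop} {k : ℕ} {x y : ℕ → A} {i j : ℕ} {a b c d : A}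

/-- Otherwise `a`, `x (2 * j)` and `b` would form a triangle. -/
theorem SlotState.of_hasShadow (htri : ∀ s t r, adj s t → adj t r → ¬ adj s r)
    (h : SlotState adj k x j a b)
    (hx : HasShadow adj x (2 * j)) : x (2 * j) = a := by
  obtain ⟨hab, h1, h2, -⟩ := h
  obtain ⟨h4, -⟩ := hx
  rcases h2 with h2 | ⟨i, -, h2, -⟩
  · exact h2
  · rw [h1] at h4
    exact absurd hab (htri _ _ _ h2 h4)

/-- A flip at the center itself interchanges `a` and `b`. A flip at a neighbouring center at most
moves `a` between the position next to center `j` and that neighbouring center, as the second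
alternatives in `SlotState` allow. -/
theorem SlotState.flip (hsymm : ∀ s t, adj s t → adj t s)
    (htri : ∀ s t r, adj s t → adj t r → ¬ adj s r) (h : SlotState adj k x j a b) (hi : i < k)
    (hxy : Flip adj x y (2 * i)) : SlotState adj k y j a b ∨ SlotState adj k y j b a := by
  by_cases hij : i = j
  · subst hij
    have ha := h.of_hasShadow htri hxy.1
    obtain ⟨hab, h1, -, -⟩ := h
    obtain ⟨-, h2, h3, h4, -⟩ := hxy
    exact .inr ⟨hsymm _ _ hab, h3.trans ha, .inl (h2.trans h1), .inl (h4.trans h1)⟩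
  · left
    obtain ⟨hab, h1, h2, h3⟩ := h
    obtain ⟨⟨h4, h4'⟩, h5, h6, h7, h8⟩ := hxy
    refine ⟨hab, (h8 _ (by omega) (by omega) (by omega)).trans h1, ?_, ?_⟩
    · by_cases hi' : i + 1 = j
      · subst hi'
        rw [show 2 * (i + 1) = 2 * i + 2 by ring] at h2 ⊢
        rcases h2 with h2 | ⟨l, hl, h2, h2'⟩
        · rw [h4'] at h2
          subst h2
          exact .inr ⟨i, rfl, by rwa [h7], h6⟩
        · obtain rfl : l = i := by omega
          exact .inl (h7.trans h2')
      · rw [h8 _ (by omega) (by omega) (by omega)]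
        refine h2.imp_right ?_
        rintro ⟨l, hl, h2, h2'⟩
        exact ⟨l, hl, h2, (h8 _ (by omega) (by omega) (by omega)).trans h2'⟩
    · by_cases hi' : i = j + 1
      · subst hi'
        rw [show 2 * (j + 1) = 2 * j + 2 by ring] at *
        rcases h3 with h3 | ⟨-, h3, h3'⟩
        · rw [h3] at h4 h6
          exact .inr ⟨hi, by rwa [h5], h6⟩
        · exact .inl (h5.trans h3')
      · rw [h8 _ (by omega) (by omega) (by omega)]
        refine h3.imp_right ?_
        rintro ⟨hl, h2, h2'⟩
        exact ⟨hl, h2, (h8 _ (by omega) (by omega) (by omega)).trans h2'⟩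

/-- If the letter between the two centers were neither `a` nor `c`, both would have been exchanged
away, and that letter would form a triangle with `c` and `d`. -/
theorem SlotState.adjacent (htri : ∀ s t r, adj s t → adj t r → ¬ adj s r)
    (h : SlotState adj k x j a b) (h' : SlotState adj k x (j + 1) c d) :
    (x (2 * j + 2) = a ∧ (c = a ∨ c = b)) ∨ (x (2 * j + 2) = c ∧ a = d) := by
  obtain ⟨hab, h1, -, h3⟩ := h
  obtain ⟨hcd, h1', h2', -⟩ := h'
  rw [show 2 * (j + 1) = 2 * j + 2 by ring] at *
  rcases h3 with h3 | ⟨-, h3, h3'⟩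
  · refine .inl ⟨h3, ?_⟩
    rcases h2' with h2' | ⟨l, hl, -, h2'⟩
    · exact .inl (h2'.symm.trans h3)
    · obtain rfl : l = j := by omega
      exact .inr (h2'.symm.trans h1)
  · have had : a = d := h3'.symm.trans h1'
    rcases h2' with h2' | ⟨l, hl, h4, h2'⟩
    · exact .inr ⟨h2', had⟩
    · obtain rfl : l = j := by omega
      rw [h1] at h2'
      subst h2'
      exact absurd h4 (htri _ _ _ (by rw [had] at hab ⊢; exact hcd) h3)

/-- The possible letters in the positions `2 * j + 1, 2 * j + 2, 2 * j + 3`. -/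
def TripleState (x : ℕ → A) (j : ℕ) (p t u : A) : Prop :=
  (x (2 * j + 1) = t ∧ x (2 * j + 2) = p ∧ x (2 * j + 3) = u) ∨
  (x (2 * j + 1) = p ∧ x (2 * j + 2) = t ∧ x (2 * j + 3) = u) ∨
  (x (2 * j + 1) = t ∧ x (2 * j + 2) = u ∧ x (2 * j + 3) = p)

/-- `SlotState.adjacent` gives the two pairs a common letter `p`; the absence of shadows between the
centers makes the pairs distinct. The three positions then hold `p`, `t`, `u` in one of three
orders, none with `p` at both centers. -/
theorem exists_tripleState (hsymm : ∀ s t, adj s t → adj t s)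
    (hirr : ∀ s, ¬ adj s s)
    (htri : ∀ s t r, adj s t → adj t r → ¬ adj s r) (w : V → ℕ → A)
    (hclosed : ∀ u i, i < k → HasShadow adj (w u) (2 * i) → ∃ v, Flip adj (w u) (w v) (2 * i))
    (hodd : ∀ u i, i + 1 < k → ¬ HasShadow adj (w u) (2 * i + 1))
    (hwit : ∀ i, i < k → ∃ u, HasShadow adj (w u) (2 * i)) {P Q : ℕ → A}
    (hPQ : ∀ u i, i < k →
      SlotState adj k (w u) i (P i) (Q i) ∨ SlotState adj k (w u) i (Q i) (P i))
    (hj : j + 1 < k) :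
    ∃ p t u : A, p ≠ t ∧ p ≠ u ∧ t ≠ u ∧ ((P j = p ∧ Q j = t) ∨ (P j = t ∧ Q j = p)) ∧
      ((P (j + 1) = p ∧ Q (j + 1) = u) ∨ (P (j + 1) = u ∧ Q (j + 1) = p)) ∧
      ∀ v, TripleState (w v) j p t u := by
  have hne : ∀ i, i < k → P i ≠ Q i := by
    intro i hi h
    obtain ⟨u, -⟩ := hwit i hi
    rcases hPQ u i hi with h' | h' <;> exact hirr (P i) (by have := h'.1; rwa [← h] at this)
  have hcenter : ∀ u i, i < k → w u (2 * i + 1) = P i ∨ w u (2 * i + 1) = Q i := by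
    intro u i hi
    rcases hPQ u i hi with h | h
    · exact .inr h.2.1
    · exact .inl h.2.1
  -- Take a word with a shadow at slot `j`. If the letter at the next center equalled either letter
  -- of that shadow, then the word itself or its flip would have a shadow at the odd index `2 * j +
  -- 1`.
  have hdiff : ∃ z, (z = P (j + 1) ∨ z = Q (j + 1)) ∧ z ≠ P j ∧ z ≠ Q j := by
    obtain ⟨v, hv⟩ := hwit j (by omega)
    obtain ⟨v', hv'⟩ := hclosed v j (by omega) hv
    have h1 : ¬ (w v (2 * j + 3) = w v (2 * j + 1)) := fun h =>
      hodd v j hj ⟨by rw [show 2 * j + 1 + 1 = 2 * j + 2 by ring, hv.2]; exact hsymm _ _ hv.1, h⟩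
    have h2 : ¬ (w v (2 * j + 3) = w v (2 * j)) := by
      intro h
      refine hodd v' j hj ⟨?_, ?_⟩
      · rw [show 2 * j + 1 + 1 = 2 * j + 2 by ring, hv'.2.2.1, hv'.2.2.2.1]
        exact hv.1
      · rw [show 2 * j + 1 + 2 = 2 * j + 3 by ring, hv'.2.2.1,
          hv'.2.2.2.2 _ (by omega) (by omega) (by omega), h]
    refine ⟨w v (2 * j + 3), hcenter v (j + 1) hj, ?_⟩
    rcases hPQ v j (by omega) with h | h
    · rw [h.of_hasShadow htri hv] at h2
      rw [h.2.1] at h1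
      exact ⟨h2, h1⟩
    · rw [h.of_hasShadow htri hv] at h2
      rw [h.2.1] at h1
      exact ⟨h1, h2⟩
  have hne1 := hne j (by omega)
  have hne2 := hne (j + 1) hj
  have hstate : ∀ v, ∃ a b c d, ((a = P j ∧ b = Q j) ∨ (a = Q j ∧ b = P j)) ∧
      ((c = P (j + 1) ∧ d = Q (j + 1)) ∨ (c = Q (j + 1) ∧ d = P (j + 1))) ∧
      w v (2 * j + 1) = b ∧ w v (2 * j + 3) = d ∧
      ((w v (2 * j + 2) = a ∧ (c = a ∨ c = b)) ∨ (w v (2 * j + 2) = c ∧ a = d)) := by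
    intro v
    rcases hPQ v j (by omega) with h | h <;> rcases hPQ v (j + 1) hj with h' | h'
    all_goals
      exact ⟨_, _, _, _, by simp, by simp, h.2.1, h'.2.1, h.adjacent htri h'⟩
  obtain ⟨z, hz⟩ := hdiff
  obtain ⟨v, -⟩ := hwit j (by omega)
  have hshare : ∃ p t u, ((P j = p ∧ Q j = t) ∨ (P j = t ∧ Q j = p)) ∧
      ((P (j + 1) = p ∧ Q (j + 1) = u) ∨ (P (j + 1) = u ∧ Q (j + 1) = p)) := by
    obtain ⟨a, b, c, d, h1, h2, -, -, h5⟩ := hstate v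
    have : (c = a ∨ c = b) ∨ a = d := h5.imp And.right And.right
    rcases this with (h | h) | h
    · exact ⟨a, b, d, by grind, by grind⟩
    · exact ⟨b, a, d, by grind, by grind⟩
    · exact ⟨a, b, c, by grind, by grind⟩
  obtain ⟨p, t, u, h1, h2⟩ := hshare
  refine ⟨p, t, u, by grind, by grind, by grind, h1, h2, fun v => ?_⟩
  obtain ⟨a, b, c, d, h3, h4, h5, h6, h7⟩ := hstate v
  rw [TripleState, h5, h6]
  grind

theorem isMedian_of_flips [Nonempty V] (hsymm : ∀ s t, adj s t → adj t s)
    (hirr : ∀ s, ¬ adj s s)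
    (htri : ∀ s t r, adj s t → adj t r → ¬ adj s r) (G : SimpleGraph V) (w : V → ℕ → A)
    (hG : ∀ u v, G.Adj u v ↔ ∃ i < k, Flip adj (w u) (w v) (2 * i))
    (hconn : G.Preconnected)
    (hclosed : ∀ u i, i < k → HasShadow adj (w u) (2 * i) → ∃ v, Flip adj (w u) (w v) (2 * i))
    (hodd : ∀ u i, i + 1 < k → ¬ HasShadow adj (w u) (2 * i + 1))
    (hwit : ∀ i, i < k → ∃ u, HasShadow adj (w u) (2 * i))
    (hinj : ∀ u v, (∀ n ≤ 2 * k, w u n = w v n) → u = v) : IsMedian G := by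
  classical
  let v₀ : V := Classical.arbitrary V
  -- The pair is read off one word with a shadow at the slot and transported along walks.
  have hpair : ∀ i, ∃ a b, i < k → ∀ u,
      SlotState adj k (w u) i a b ∨ SlotState adj k (w u) i b a := by
    intro i
    by_cases hi : i < k
    · obtain ⟨v, hv⟩ := hwit i hi
      refine ⟨w v (2 * i), w v (2 * i + 1), fun _ u => ?_⟩
      obtain ⟨p⟩ := hconn u v
      induction p with
      | nil => exact .inl hv.slotState
      | cons h p ih =>
        obtain ⟨l, hl, hf⟩ := (hG _ _).1 h.symm
        rcases ih hv with h | h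
        · exact h.flip hsymm htri hl hf
        · exact (h.flip hsymm htri hl hf).symm
    · exact ⟨w v₀ 0, w v₀ 0, fun h => absurd h hi⟩
  choose P Q hPQ using hpair
  replace hPQ : ∀ u i, i < k →
      SlotState adj k (w u) i (P i) (Q i) ∨ SlotState adj k (w u) i (Q i) (P i) :=
    fun u i hi => hPQ i hi u
  have hne : ∀ i, i < k → P i ≠ Q i := by
    intro i hi h
    rcases hPQ v₀ i hi with h' | h' <;> exact hirr (P i) (by have := h'.1; rwa [← h] at this)
  have htriple : ∀ j, ∃ p t u, j + 1 < k →
      p ≠ t ∧ p ≠ u ∧ t ≠ u ∧ ((P j = p ∧ Q j = t) ∨ (P j = t ∧ Q j = p)) ∧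
      ((P (j + 1) = p ∧ Q (j + 1) = u) ∨ (P (j + 1) = u ∧ Q (j + 1) = p)) ∧
      ∀ v, TripleState (w v) j p t u := by
    intro j
    by_cases hj : j + 1 < k
    · obtain ⟨p, t, u, h⟩ := exists_tripleState hsymm hirr htri w hclosed hodd hwit hPQ hj
      exact ⟨p, t, u, fun _ => h⟩
    · exact ⟨w v₀ 0, w v₀ 0, w v₀ 0, fun h => absurd h hj⟩
  choose p t u hp using htriple
  have hcenter : ∀ v i, i < k → w v (2 * i + 1) = P i ∨ w v (2 * i + 1) = Q i := by
    intro v i hi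
    rcases hPQ v i hi with h | h
    · exact .inr h.2.1
    · exact .inl h.2.1
  let φ : V → Fin k → Bool := fun v i => decide (w v (2 * i + 1) = P i)
  have hφflip : ∀ v v' i (hi : i < k), Flip adj (w v) (w v') (2 * i) →
      φ v' = Function.update (φ v) ⟨i, hi⟩ (!(φ v ⟨i, hi⟩)) := by
    intro v v' i hi h
    ext1 l
    by_cases hl : l = ⟨i, hi⟩
    · subst hl
      rw [Function.update_self]
      have h1 := hcenter v i hi
      have h2 := hcenter v' i hi
      have h3 := hne i hi
      have h4 : w v' (2 * i + 1) ≠ w v (2 * i + 1) := by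
        rw [h.2.2.1]
        intro h5
        exact hirr _ (h5 ▸ h.1.1)
      simp only [φ]
      grind
    · rw [Function.update_of_ne hl]
      have : (l : ℕ) ≠ i := fun h => hl (Fin.ext h)
      simp only [φ]
      rw [h.2.2.2.2 _ (by omega) (by omega) (by omega)]
  -- These `e j` and `f j` are the Boolean codes of the letter `p j` at the centers `j` and `j + 1`.
  refine isMedian_of_pathConstraint (k := k) (e := fun j => decide (p j = P j))
    (f := fun j => decide (p j = P (j + 1))) G φ ?_ ?_ ?_ ?_
  · intro v v' h
    have hc : ∀ i, i < k → w v (2 * i + 1) = w v' (2 * i + 1) := by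
      intro i hi
      have h1 := congrFun h ⟨i, hi⟩
      have h2 := hcenter v i hi
      have h3 := hcenter v' i hi
      simp only [φ, decide_eq_decide] at h1
      grind
    -- In each of the three states the middle letter is the one of `p`, `t`, `u` missing from the
    -- centers.
    have hmid : ∀ i, i + 1 < k → w v (2 * i + 2) = w v' (2 * i + 2) := by
      intro i hi
      have h1 := hc i (by omega)
      have h2 := hc (i + 1) hi
      rw [show 2 * (i + 1) + 1 = 2 * i + 3 by ring] at h2
      obtain ⟨h3, h4, -, -, -, h5⟩ := hp i hi
      have h6 := h5 v
      have h7 := h5 v'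
      simp only [TripleState] at h6 h7
      grind
    rcases Nat.eq_zero_or_pos k with rfl | hk
    · obtain ⟨q⟩ := hconn v v'
      cases q with
      | nil => rfl
      | cons h _ =>
        obtain ⟨i, hi, -⟩ := (hG _ _).1 h
        omega
    -- An end position has no center beyond it, so it holds the letter of its pair that is not at
    -- the center.
    have hfirst : w v 0 = w v' 0 := by
      have h1 := hc 0 hk
      have h2 := hne 0 hk
      have h3 : ∀ v a b, SlotState adj k (w v) 0 a b → w v 0 = a ∧ w v 1 = b := by
        rintro v a b ⟨-, h4, h5 | ⟨i, hi, -⟩, -⟩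
        · exact ⟨h5, h4⟩
        · omega
      simp only [mul_zero, zero_add] at h1
      rcases hPQ v 0 hk with h | h <;> rcases hPQ v' 0 hk with h' | h' <;>
        have h4 := h3 _ _ _ h <;> have h5 := h3 _ _ _ h' <;> grind
    have hlast : w v (2 * (k - 1) + 2) = w v' (2 * (k - 1) + 2) := by
      have h1 := hc (k - 1) (by omega)
      have h2 := hne (k - 1) (by omega)
      have h3 : ∀ v a b, SlotState adj k (w v) (k - 1) a b →
          w v (2 * (k - 1) + 2) = a ∧ w v (2 * (k - 1) + 1) = b := by
        rintro v a b ⟨-, h4, -, h5 | ⟨hi, -⟩⟩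
        · exact ⟨h5, h4⟩
        · omega
      rcases hPQ v (k - 1) (by omega) with h | h <;>
        rcases hPQ v' (k - 1) (by omega) with h' | h' <;>
        have h4 := h3 _ _ _ h <;> have h5 := h3 _ _ _ h' <;> grind
    refine hinj v v' fun n hn => ?_
    rcases Nat.even_or_odd' n with ⟨l, rfl | rfl⟩
    · rcases l with - | l
      · exact hfirst
      · by_cases hl : l + 1 < k
        · exact hmid l hl
        · obtain rfl : l = k - 1 := by omega
          exact hlast
    · exact hc l (by omega)
  · rintro v j hj ⟨h1, h2⟩
    simp only [φ, decide_eq_decide] at h1 h2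
    rw [show 2 * (j + 1) + 1 = 2 * j + 3 by ring] at h2
    obtain ⟨h3, h4, h5, h6, h7, h8⟩ := hp j hj
    have h9 := h8 v
    simp only [TripleState] at h9
    grind
  · intro v v' h
    obtain ⟨i, hi, h⟩ := (hG _ _).1 h
    rw [hφflip _ _ _ hi h]
    exact hammingDist_update_self _ _ _ (by simp)
  · rintro v ⟨j, hj⟩ hC
    -- If the shared letter is at a neighbouring center and not at center `j`, flipping coordinate
    -- `j` would put it at both, against `hC`.
    have hleft : ∀ i (hi : i + 1 < k), ¬ (p i = w v (2 * i + 1) ∧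
        p i ≠ w v (2 * i + 3) ∧ i + 1 = j) := by
      rintro i hi ⟨h1, h2, rfl⟩
      apply hC i hi
      obtain ⟨h3, h4, h5, h6, h7, h8⟩ := hp i hi
      have h9 := h8 v
      simp only [TripleState] at h9
      rw [Function.update_self, Function.update_of_ne (by simp)]
      simp only [φ]
      rw [show 2 * (i + 1) + 1 = 2 * i + 3 by ring]
      grind
    have hright : ∀ hi : j + 1 < k, ¬ (p j ≠ w v (2 * j + 1) ∧ p j = w v (2 * j + 3)) := by
      rintro hi ⟨h1, h2⟩
      apply hC j hi
      obtain ⟨h3, h4, h5, h6, h7, h8⟩ := hp j hi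
      have h9 := h8 v
      simp only [TripleState] at h9
      rw [Function.update_self, Function.update_of_ne (by simp)]
      simp only [φ]
      rw [show 2 * (j + 1) + 1 = 2 * j + 3 by ring]
      grind
    -- A letter `a` absent from a side of center `j` is the shared letter, sitting at the
    -- neighbouring center; this is what `hleft` and `hright` exclude.
    have hshadow : ∀ a b, ((a = P j ∧ b = Q j) ∨ (a = Q j ∧ b = P j)) →
        SlotState adj k (w v) j a b → HasShadow adj (w v) (2 * j) := by
      rintro a b hab' ⟨hab, h1, h2, h3⟩
      have h2 : w v (2 * j) = a := by
        rcases h2 with h2 | ⟨i, rfl, h2, h2'⟩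
        · exact h2
        · rw [show 2 * (i + 1) = 2 * i + 2 by ring] at *
          have h4 := hleft i hj
          obtain ⟨h3, h4, h5, h6, h7, h8⟩ := hp i hj
          have h9 := h8 v
          simp only [TripleState] at h9
          grind
      have h3 : w v (2 * j + 2) = a := by
        rcases h3 with h3 | ⟨hj', h3, h3'⟩
        · exact h3
        · have h4 := hright hj'
          obtain ⟨h3, h4, h5, h6, h7, h8⟩ := hp j hj'
          have h9 := h8 v
          simp only [TripleState] at h9
          grind
      exact ⟨by rwa [h1, h2], h3.trans h2.symm⟩
    have hs : HasShadow adj (w v) (2 * j) := by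
      rcases hPQ v j hj with h | h
      · exact hshadow _ _ (by simp) h
      · exact hshadow _ _ (by simp) h
    obtain ⟨v', hv'⟩ := hclosed v j hj hs
    exact ⟨v', (hG _ _).2 ⟨j, hj, hv'⟩, hφflip _ _ _ hj hv'⟩

end Slots


/-! ### From lists and braid moves to letter functions and flips -/

section Words

variable {B : Type*} {M : CoxeterMatrix B}

theorem braidWord_of_eq_three {s t : B} (h : M s t = 3) :
    CoxeterSystem.braidWord M s t = [t, s, t] := by
  rw [CoxeterSystem.braidWord, h]
  rfl

theorem eq_take_append_getD_append_drop (β : List B) (d : B) {i : ℕ} (h : i + 2 < β.length) :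
    β = β.take i ++ [β.getD i d, β.getD (i + 1) d, β.getD (i + 2) d] ++ β.drop (i + 3) := by
  have h1 : β.drop i = [β.getD i d, β.getD (i + 1) d, β.getD (i + 2) d] ++ β.drop (i + 3) := by
    rw [List.drop_eq_getElem_cons (by omega), List.drop_eq_getElem_cons (by omega),
      List.drop_eq_getElem_cons (by omega), List.getD_eq_getElem _ _ (by omega),
      List.getD_eq_getElem _ _ (by omega), List.getD_eq_getElem _ _ (by omega)]
    rfl
  rw [List.append_assoc, ← h1, List.take_append_drop]

theorem getD_append_triple (u v : List B) (a b c d : B) :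
    (u ++ [a, b, c] ++ v).getD u.length d = a ∧ (u ++ [a, b, c] ++ v).getD (u.length + 1) d = b ∧
      (u ++ [a, b, c] ++ v).getD (u.length + 2) d = c := by
  simp [List.getD_eq_getElem?_getD]

theorem getD_append_triple_of_ne (u v : List B) (a b c a' b' c' d : B) {n : ℕ}
    (h0 : n ≠ u.length) (h1 : n ≠ u.length + 1) (h2 : n ≠ u.length + 2) :
    (u ++ [a, b, c] ++ v).getD n d = (u ++ [a', b', c'] ++ v).getD n d := by
  rcases lt_or_ge n u.length with h | h
  · simp [List.getD_eq_getElem?_getD, List.getElem?_append_left h]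
  · obtain ⟨m, rfl⟩ : ∃ m, n = u.length + (m + 3) := ⟨n - u.length - 3, by omega⟩
    simp [List.getD_eq_getElem?_getD, List.getElem?_append_right]

theorem BraidMove.length_eq {β γ : List B} (h : BraidMove M β γ) : γ.length = β.length := by
  obtain ⟨u, v, s, t, -, rfl, rfl⟩ := h
  simp [M.symmetric t s]

theorem length_of_mem_braidClass {α β : List B} (h : β ∈ braidClass M α) :
    β.length = α.length := by
  induction h with
  | refl => rfl
  | tail _ hb ih => exact hb.length_eq.trans ih

/-- The shift by 2 turns the starting index of a shadow, counted from 0, into its center, counted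
from 1. -/
theorem mem_braidShadows_iff (d : B) (β : List B) (i : ℕ) :
    i + 2 ∈ braidShadows M β ↔
      i + 2 < β.length ∧ HasShadow (fun s t => M s t = 3) (fun n => β.getD n d) i := by
  constructor
  · rintro ⟨u, v, s, t, hst, rfl, hi⟩
    obtain rfl : i = u.length := by omega
    obtain ⟨h1, h2, h3⟩ := getD_append_triple u v s t s d
    refine ⟨by simp, ?_, ?_⟩
    · simp only [h1, h2, hst]
    · simp only [h1, h3]
  · rintro ⟨hi, h1, h2⟩
    have h := eq_take_append_getD_append_drop β d hi
    simp only at h1 h2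
    rw [h2] at h
    exact ⟨_, _, _, _, h1, h, by rw [List.length_take]; omega⟩

theorem exists_flip_of_braidMove (hM : IsSimplyLaced M) (d : B) {β γ : List B}
    (h : BraidMove M β γ) : ∃ i, i + 2 < β.length ∧
      Flip (fun s t => M s t = 3) (fun n => β.getD n d) (fun n => γ.getD n d) i := by
  obtain ⟨u, v, s, t, hst, hβ, hγ⟩ := h
  have hst : M s t = 3 := le_antisymm (hM s t).2 hst
  have hts : M t s = 3 := by rwa [M.symmetric t s]
  rw [braidWord_of_eq_three hst] at hβ
  rw [braidWord_of_eq_three hts] at hγ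
  subst hβ hγ
  obtain ⟨h1, h2, h3⟩ := getD_append_triple u v t s t d
  obtain ⟨h1', h2', h3'⟩ := getD_append_triple u v s t s d
  refine ⟨u.length, by simp, ⟨?_, ?_⟩, ?_, ?_, ?_, ?_⟩
  · simp only [h1, h2, hts]
  · simp only [h1, h3]
  · simp only [h1', h2]
  · simp only [h1, h2']
  · simp only [h3', h2]
  · intro n hn0 hn1 hn2
    exact getD_append_triple_of_ne u v _ _ _ _ _ _ d hn0 hn1 hn2

theorem exists_braidMove_of_hasShadow (d : B) {β : List B} {i : ℕ} (hi : i + 2 < β.length)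
    (h : HasShadow (fun s t => M s t = 3) (fun n => β.getD n d) i) :
    ∃ γ, BraidMove M β γ ∧
      Flip (fun s t => M s t = 3) (fun n => β.getD n d) (fun n => γ.getD n d) i := by
  have hβ := eq_take_append_getD_append_drop β d hi
  obtain ⟨hst, h2⟩ := id h
  simp only at hst h2
  rw [h2] at hβ
  have hlen : (β.take i).length = i := by rw [List.length_take]; omega
  generalize β.take i = u at hβ hlen
  generalize β.drop (i + 3) = v at hβ
  obtain ⟨s, hs⟩ : ∃ s, β.getD i d = s := ⟨_, rfl⟩
  obtain ⟨t, ht⟩ : ∃ t, β.getD (i + 1) d = t := ⟨_, rfl⟩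
  subst hlen
  rw [hs, ht] at hst hβ
  have hts : M t s = 3 := by rwa [M.symmetric t s]
  obtain ⟨h1', h2', h3'⟩ := getD_append_triple u v t s t d
  refine ⟨u ++ [t, s, t] ++ v, ⟨u, v, t, s, hts.ge, ?_, ?_⟩, h, ?_, ?_, ?_, ?_⟩
  · rw [braidWord_of_eq_three hts, hβ]
  · rw [braidWord_of_eq_three hst]
  · simp only [h1', ht]
  · simp only [h2', hs]
  · simp only [h3', ht]
  · intro n hn0 hn1 hn2
    simp only
    rw [hβ]
    exact getD_append_triple_of_ne u v _ _ _ _ _ _ d hn0 hn1 hn2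

theorem eq_of_getD_eq (d : B) {β γ : List B} (hl : β.length = γ.length)
    (h : ∀ n < β.length, β.getD n d = γ.getD n d) : β = γ := by
  refine List.ext_getElem hl fun n h1 h2 => ?_
  have := h n h1
  rwa [List.getD_eq_getElem _ _ h1, List.getD_eq_getElem _ _ h2] at this

theorem braidGraph_preconnected (M : CoxeterMatrix B) (α : List B) :
    (braidGraph M α).Preconnected := by
  have h : ∀ β (hβ : β ∈ braidClass M α),
      (braidGraph M α).Reachable ⟨α, Relation.ReflTransGen.refl⟩ ⟨β, hβ⟩ := by
    intro β hβ
    induction hβ with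
    | refl => exact .rfl
    | @tail b c hb hbc ih =>
      exact ih.trans (SimpleGraph.Adj.reachable
        (show (braidGraph M α).Adj ⟨b, hb⟩ ⟨c, hb.tail hbc⟩ from hbc))
  exact fun u v => (h u.1 u.2).symm.trans (h v.1 v.2)

theorem classBraidShadows_eq_of_length_eq_one {α : List B} (h : α.length = 1) :
    classBraidShadows M α = {i | Even i ∧ 2 ≤ i ∧ i + 1 ≤ α.length} := by
  ext i
  simp only [classBraidShadows, Set.mem_iUnion]
  constructor
  · rintro ⟨β, hβ, u, v, s, t, -, h1, -⟩
    have h2 := length_of_mem_braidClass hβ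
    rw [h1, h] at h2
    simp at h2
    omega
  · rintro ⟨-, h1, h2⟩
    omega

end Words

end BraidMedian

/-! ### The braid graph of a link -/

theorem mainTheorem1 {B W : Type*} [Group W] {M : CoxeterMatrix B} (cs : CoxeterSystem M W)
    (hM : BraidMedian.IsTypeLambda M) (α : List B) (hα : BraidMedian.IsLink cs α) :
    BraidMedian.IsMedian (BraidMedian.braidGraph M α) := by
  open BraidMedian in
  obtain ⟨hlaced, hfree⟩ := hM
  obtain ⟨hodd, hshadows⟩ : Odd α.length ∧
      classBraidShadows M α = {i | Even i ∧ 2 ≤ i ∧ i + 1 ≤ α.length} :=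
    hα.2.elim (fun h => ⟨h ▸ odd_one, classBraidShadows_eq_of_length_eq_one h⟩) id
  obtain ⟨k, hk⟩ := hodd
  -- A letter of `α` serves as the default of `getD`; all words of the class have the same length,
  -- so they agree beyond the last position.
  obtain ⟨d, -⟩ := List.exists_mem_of_length_pos (l := α) (by omega)
  have hlen : ∀ β : braidClass M α, β.1.length = 2 * k + 1 :=
    fun β => (length_of_mem_braidClass β.2).trans hk
  have hmem : ∀ i, (∃ β : braidClass M α, i + 2 < 2 * k + 1 ∧
      HasShadow (fun s t => M s t = 3) (fun n => β.1.getD n d) i) ↔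
      Even i ∧ i + 2 < 2 * k + 1 := by
    intro i
    have h := Set.ext_iff.1 hshadows (i + 2)
    simp only [classBraidShadows, Set.mem_iUnion, mem_braidShadows_iff d, Set.mem_ofPred_eq, hk,
      Nat.even_add, even_two, iff_true] at h
    constructor
    · rintro ⟨β, h1, h2⟩
      obtain ⟨h3, -, h4⟩ := h.1 ⟨β.1, β.2, by rwa [hlen], h2⟩
      exact ⟨h3, by omega⟩
    · rintro ⟨h1, h2⟩
      obtain ⟨β, hβ, h3, h4⟩ := h.2 ⟨h1, by omega, by omega⟩
      exact ⟨⟨β, hβ⟩, h2, h4⟩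
  have : Nonempty (braidClass M α) := ⟨⟨α, Relation.ReflTransGen.refl⟩⟩
  refine isMedian_of_flips (adj := fun s t => M s t = 3) (k := k) ?_ ?_ ?_ (braidGraph M α)
    (fun β n => β.1.getD n d) ?_ (braidGraph_preconnected M α) ?_ ?_ ?_ ?_
  · intro s t h
    rwa [M.symmetric t s]
  · intro s h
    simp at h
  · intro s t r h1 h2 h3
    classical
    exact hfree {s, t, r} (SimpleGraph.is3Clique_triple_iff.2
      ⟨.inl h1.ge, .inl h3.ge, .inl h2.ge⟩)
  · intro u v
    constructor
    · intro h
      obtain ⟨i, hi, hf⟩ := exists_flip_of_braidMove hlaced d (show BraidMove M u.1 v.1 from h)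
      rw [hlen] at hi
      obtain ⟨⟨l, rfl⟩, -⟩ := (hmem i).1 ⟨u, hi, hf.1⟩
      exact ⟨l, by omega, by rwa [two_mul]⟩
    · rintro ⟨i, hi, hf⟩
      obtain ⟨γ, hγ, hf'⟩ := exists_braidMove_of_hasShadow (β := u.1) d
        (by rw [hlen]; omega) hf.1
      have : γ = v.1 := by
        -- A flip at a given place determines the resulting word.
        refine eq_of_getD_eq d (by rw [hγ.length_eq, hlen, hlen]) fun n _ => ?_
        obtain ⟨-, h1, h2, h3, h4⟩ := hf
        obtain ⟨-, h1', h2', h3', h4'⟩ := hf'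
        grind
      exact (this ▸ hγ : BraidMove M u.1 v.1)
  · intro u i hi hs
    obtain ⟨γ, hγ, hf⟩ := exists_braidMove_of_hasShadow (β := u.1) d (by rw [hlen]; omega) hs
    exact ⟨⟨γ, u.2.tail hγ⟩, hf⟩
  · intro u i hi hs
    obtain ⟨h, -⟩ := (hmem (2 * i + 1)).1 ⟨u, by omega, hs⟩
    exact absurd h (by simp)
  · intro i hi
    obtain ⟨u, -, hu⟩ := (hmem (2 * i)).2 ⟨by simp, by omega⟩
    exact ⟨u, hu⟩
  · intro u v h
    exact Subtype.ext (eq_of_getD_eq d (by rw [hlen, hlen]) fun n hn =>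
      h n (by rw [hlen] at hn; omega))
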